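/- **Lemma (Angularly refined bilinear Strichartz estimate).** Write $\langle y\rangle := (1+|y|^2)^{1/2}$. For $v \in L^2(\mathbb{R}\times\mathbb{R}^2)$ let $\tilde v$ be the spacetime Fourier transform, $$\tilde v(\tau,\xi) := \int_{\mathbb{R}}\int_{\mathbb{R}^2} e^{-i(t\tau + x\cdot\xi)}\, v(t,x)\,dx\,dt$$ (extended to $L^2$ by Plancherel), and for $b \ge 0$ let $X^{0,b}$ be the space of all $v \in L^2(\mathbb{R}\times\mathbb{R}^2;\mathbb{C})$ with finite norm $$\|v\|_{X^{0,b}} := \big\| \langle \tau+|\xi|^2\rangle^{b}\, \tilde v(\tau,\xi)\big\|_{L^2_{\tau,\xi}(\mathbb{R}\times\mathbb{R}^2)} .$$ For $A \ge 1$ and $N>0$, say that $v$ has spatial frequency $N$ (with constant $A$) if $\tilde v$ vanishes almost everywhere outside $\{(\tau,\xi) : A^{-1}N \le \langle\xi\rangle \le AN\}$. For every $\varepsilon>0$ and every $A \ge 1$ there is a constant $C = C(\varepsilon,A) > 0$ such that the following holds. Let $0<N_1\le N_2$ and $0<\theta<\frac1{50}$, and let $v_1, v_2\in X^{0,1/2+\varepsilon}$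 have spatial frequencies $N_1, N_2$ respectively (with constant $A$). Then for every $(t,x) \in \mathbb{R}\times\mathbb{R}^2$ the integral $$F(t,x) := \int_{\mathbb{R}}\int_{\mathbb{R}}\int_{\mathbb{R}^2}\int_{\mathbb{R}^2} e^{i(t(\tau_1+\tau_2)+x\cdot(\xi_1+\xi_2))}\, 1_{|\cos\angle(\xi_1,\xi_2)|\le\theta}\, \tilde v_1(\tau_1,\xi_1)\,\tilde v_2(\tau_2,\xi_2)\, d\xi_1\, d\xi_2\, d\tau_1\, d\tau_2$$ converges absolutely, the function $F$ belongs to $L^2_{t,x}(\mathbb{R}\times\mathbb{R}^2)$, and $$\|F\|_{L^2_{t,x}} \le C\, \theta^{1/2}\, \|v_1\|_{X^{0,1/2+\varepsilon}}\, \|v_2\|_{X^{0,1/2+\varepsilon}} .$$ -/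

import Mathlib

open MeasureTheory

noncomputable section

namespace AngularStrichartz

/-- The plane `ℝ²` with its Euclidean structure. -/
abbrev Plane := EuclideanSpace ℝ (Fin 2)

/-- Spacetime `ℝ × ℝ²`, with its Euclidean structure and Lebesgue measure. A point is `(t, x)` in
physical space and `(τ, ξ)` in frequency space: `z.fst` is the time (frequency) and
`z.snd` the spatial variable (frequency). -/
abbrev Spacetime := WithLp 2 (ℝ × Plane)

/-- The Japanese bracket `⟨y⟩ = (1 + |y|²)^{1/2}`. -/
def bracket {V : Type*} [NormedAddCommGroup V] (y : V) : ℝ := Real.sqrt (1 + ‖y‖ ^ 2)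

/-- The spacetime Fourier transform with the normalization
`ṽ(τ, ξ) = ∫ e^{-i (t τ + x · ξ)} v(t, x) dx dt`, extended to `L²` by Plancherel.
Mathlib's Fourier transform `𝓕` has the kernel `e^{-2 π i ⟨z, ζ⟩}`, whence the rescaling. -/
def stFourier (v : Lp ℂ 2 (volume : Measure Spacetime)) (ζ : Spacetime) : ℂ :=
  (FourierTransform.fourier v : Lp ℂ 2 (volume : Measure Spacetime)) ((2 * Real.pi)⁻¹ • ζ)

/-- The norm `‖v‖_{X^{s,b}} = ‖ ⟨ξ⟩^s ⟨τ + |ξ|²⟩^b ṽ(τ, ξ) ‖_{L²_{τ,ξ}}`, possibly infinite. -/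
def XNorm (s b : ℝ) (v : Lp ℂ 2 (volume : Measure Spacetime)) : ENNReal :=
  eLpNorm (fun ζ : Spacetime =>
    ((bracket ζ.snd ^ s * bracket (ζ.fst + ‖ζ.snd‖ ^ 2) ^ b : ℝ) : ℂ) * stFourier v ζ) 2 volume

/-- Membership in `X^{s,b}`. For `s, b ≥ 0` the weights are at least `1`, so `X^{s,b}` is
a subspace of `L²(ℝ × ℝ²)` and consists of the `L²` functions with finite norm. -/
def MemX (s b : ℝ) (v : Lp ℂ 2 (volume : Measure Spacetime)) : Prop := XNorm s b v < ⊤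

/-- `v` has spatial frequency `N`, with constant `A` in the relation `∼`: its spacetime Fourier
transform is supported on `{A⁻¹ N ≤ ⟨ξ⟩ ≤ A N}`. -/
def HasSpatialFrequency (A N : ℝ) (v : Lp ℂ 2 (volume : Measure Spacetime)) : Prop :=
  ∀ᵐ ζ : Spacetime, ¬ (A⁻¹ * N ≤ bracket ζ.snd ∧ bracket ζ.snd ≤ A * N) → stFourier v ζ = 0

open Classical in
/-- The integrand
`e^{i (t (τ₁ + τ₂) + x · (ξ₁ + ξ₂))} 1_{|cos ∠(ξ₁, ξ₂)| ≤ θ} ṽ₁(τ₁, ξ₁) ṽ₂(τ₂, ξ₂)`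
at the point `z = (t, x)`, as a function of `p = ((τ₁, ξ₁), (τ₂, ξ₂))`. -/
def angularIntegrand (θ : ℝ) (v₁ v₂ : Lp ℂ 2 (volume : Measure Spacetime)) (z : Spacetime)
    (p : Spacetime × Spacetime) : ℂ :=
  Complex.exp (Complex.I *
      ((z.fst * (p.1.fst + p.2.fst) + inner ℝ z.snd (p.1.snd + p.2.snd) : ℝ) : ℂ)) *
    (if |Real.cos (InnerProductGeometry.angle p.1.snd p.2.snd)| ≤ θ then 1 else 0) *
    stFourier v₁ p.1 * stFourier v₂ p.2

/-- The bilinear interaction of `v₁` and `v₂` restricted to `|cos ∠(ξ₁, ξ₂)| ≤ θ`. -/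
def angularProduct (θ : ℝ) (v₁ v₂ : Lp ℂ 2 (volume : Measure Spacetime)) (z : Spacetime) : ℂ :=
  ∫ p : Spacetime × Spacetime, angularIntegrand θ v₁ v₂ z p

end AngularStrichartz

end

/-! By Plancherel it suffices to bound in `L²` the convolution of `ṽ₁` and `ṽ₂` restricted to nearly
orthogonal frequencies. The usual Cauchy–Schwarz argument, applied at once, gains nothing in `θ`.
Write `ξ₁ = ξ/2 + η`, `ξ₂ = ξ/2 - η`: the resonance function is `|ξ|²/2 + 2|η|²` and `ξ₁ · ξ₂ =
|ξ|²/4 - |η|²`, so both the modulation and the angular condition constrain only `|η|`, and a whole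
circle of directions can survive.

The remedy is to average over orthonormal frames, indexed by an angle `α`. A nearly orthogonal pair
has `ξ₁` almost on the first axis and `ξ₂` almost on the second, for a set of `α` of measure at
least `θ` (`ofReal_le_volume_frames`). In one fixed frame, `ξ` determines the direction of `η` up to
`O(θ)` (`exists_direction`), so `η` runs over a narrow double sector. Since `r dr = d(r²)/2`,
Cauchy–Schwarz there costs only `O(θ)` in the squared norm (`lintegral_aligned_weight_le`).

The frames are summed by Minkowski and Cauchy–Schwarz in `α`. Each nonzero frequency is aligned with
an axis only for a set of `α` of measure `O(θ)`, so averaging gives another `θ` for each factor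
(`lintegral_lintegral_aligned_le`). Altogether `θ² ‖conv‖² ≲ θ · θ · θ`, which is the claim. The
frequency localization serves only to make `ṽ₁` and `ṽ₂` integrable, hence the integral absolutely
convergent. -/

/-! ### Integral inequalities and scaling. -/

/-- Cauchy–Schwarz for the Lebesgue integral, in squared form. -/
theorem lintegral_mul_sq_le {α : Type*} [MeasurableSpace α] {μ : Measure α} {f g : α → ENNReal}
    (hf : AEMeasurable f μ) (hg : AEMeasurable g μ) :
    (∫⁻ x, f x * g x ∂μ) ^ 2 ≤ (∫⁻ x, f x ^ 2 ∂μ) * ∫⁻ x, g x ^ 2 ∂μ := by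
  have h := ENNReal.lintegral_mul_le_Lp_mul_Lq μ Real.HolderConjugate.two_two hf hg
  simp only [Pi.mul_apply, ENNReal.rpow_two] at h
  calc _ ≤ _ := pow_le_pow_left₀ zero_le h 2
    _ = _ := by
      rw [mul_pow]
      simp only [← ENNReal.rpow_two, ← ENNReal.rpow_mul]
      norm_num

theorem lintegral_sqrt_mul_sq_le {α : Type*} [MeasurableSpace α] {μ : Measure α}
    {f g : α → ENNReal} (hf : AEMeasurable f μ) (hg : AEMeasurable g μ) :
    (∫⁻ x, (f x * g x) ^ (1 / 2 : ℝ) ∂μ) ^ 2 ≤ (∫⁻ x, f x ∂μ) * ∫⁻ x, g x ∂μ := by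
  have h := lintegral_mul_sq_le (hf.pow_const (1 / 2 : ℝ)) (hg.pow_const (1 / 2 : ℝ))
  simp only [← ENNReal.rpow_two, ← ENNReal.rpow_mul] at h
  norm_num at h
  simpa [ENNReal.mul_rpow_of_nonneg] using h

/-- Minkowski's integral inequality in `L²`, in squared form. -/
theorem lintegral_lintegral_sq_le {α β : Type*} [MeasurableSpace α] [MeasurableSpace β]
    {μ : Measure α} {ν : Measure β} [SFinite μ] [SFinite ν] {φ : α → β → ENNReal}
    (hφ : Measurable (Function.uncurry φ)) :
    ∫⁻ y, (∫⁻ x, φ x y ∂μ) ^ 2 ∂ν ≤ (∫⁻ x, (∫⁻ y, φ x y ^ 2 ∂ν) ^ (1 / 2 : ℝ) ∂μ) ^ 2 := by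
  -- The square becomes a double integral over `(x, x')`; after Tonelli, Cauchy–Schwarz in `y`
  -- applies to each pair.
  have h1 : ∀ y, (∫⁻ x, φ x y ∂μ) ^ 2 = ∫⁻ x, ∫⁻ x', φ x y * φ x' y ∂μ ∂μ := fun y => by
    have hm : Measurable fun x => φ x y := hφ.comp (measurable_id.prodMk measurable_const)
    simp_rw [lintegral_const_mul _ hm]
    rw [lintegral_mul_const _ hm, sq]
  have h2 : Measurable fun x => (∫⁻ y, φ x y ^ 2 ∂ν) ^ (1 / 2 : ℝ) :=
    ((hφ.pow_const 2).lintegral_prod_right').pow_const _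
  have hm3 : Measurable fun p : (β × α) × α => φ p.1.2 p.1.1 * φ p.2 p.1.1 :=
    (hφ.comp (by fun_prop : Measurable fun p : (β × α) × α => (p.1.2, p.1.1))).mul
      (hφ.comp (by fun_prop : Measurable fun p : (β × α) × α => (p.2, p.1.1)))
  simp_rw [h1]
  rw [lintegral_lintegral_swap hm3.lintegral_prod_right'.aemeasurable, sq,
    ← lintegral_mul_const _ h2]
  refine lintegral_mono fun x => ?_
  rw [← lintegral_const_mul _ h2, lintegral_lintegral_swap (f := fun y x' => φ x y * φ x' y)
    (hm3.comp (by fun_prop : Measurable fun p : β × α => ((p.1, x), p.2))).aemeasurable]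
  refine lintegral_mono fun x' => ?_
  have hx : ∀ x, Measurable fun y => φ x y := fun x =>
    hφ.comp (measurable_const.prodMk measurable_id)
  have h := lintegral_mul_sq_le (μ := ν) (hx x).aemeasurable (hx x').aemeasurable
  have h' := ENNReal.rpow_le_rpow h (by norm_num : (0 : ℝ) ≤ 1 / 2)
  rw [← ENNReal.rpow_two, ← ENNReal.rpow_mul, ENNReal.mul_rpow_of_nonneg _ _ (by norm_num)] at h'
  norm_num at h'
  simpa using h'

/-- A weighted convolution bound: if the weights `a`, `b` satisfy `a * b ≤ K` on average on each
fibre `x + y = z`, the convolution of `a f` and `b g` is bounded in `L²`. -/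
theorem lintegral_convolution_sq_le {G : Type*} [MeasurableSpace G] [AddCommGroup G]
    [MeasurableAdd₂ G] [MeasurableNeg G] {μ : Measure G} [SFinite μ] [μ.IsAddLeftInvariant]
    {a b f g : G → ENNReal} {K : ENNReal} (ha : Measurable a) (hb : Measurable b)
    (hf : Measurable f) (hg : Measurable g)
    (hK : ∀ z, ∫⁻ x, (a x * b (z - x)) ^ 2 ∂μ ≤ K) :
    ∫⁻ z, (∫⁻ x, (a x * f x) * (b (z - x) * g (z - x)) ∂μ) ^ 2 ∂μ ≤
      K * ((∫⁻ x, f x ^ 2 ∂μ) * ∫⁻ x, g x ^ 2 ∂μ) := by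
  have key : ∀ z, (∫⁻ x, (a x * f x) * (b (z - x) * g (z - x)) ∂μ) ^ 2 ≤
      K * ∫⁻ x, (f x * g (z - x)) ^ 2 ∂μ := fun z => by
    calc _ = (∫⁻ x, (a x * b (z - x)) * (f x * g (z - x)) ∂μ) ^ 2 := by
          congr 1; exact lintegral_congr fun x => by ring
      _ ≤ _ := lintegral_mul_sq_le (by fun_prop) (by fun_prop)
      _ ≤ _ := by gcongr; exact hK z
  refine (lintegral_mono key).trans ?_
  have hm : Measurable fun p : G × G => (f p.2 * g (p.1 - p.2)) ^ 2 := by fun_prop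
  rw [lintegral_const_mul _ hm.lintegral_prod_right']
  gcongr
  rw [lintegral_lintegral_swap hm.aemeasurable, ← lintegral_mul_const _ (by fun_prop)]
  refine lintegral_mono fun x => ?_
  simp_rw [mul_pow]
  rw [lintegral_const_mul _ (by fun_prop), lintegral_sub_right_eq_self (fun y => g y ^ 2) x]

theorem lintegral_comp_smul {E : Type*} [NormedAddCommGroup E] [NormedSpace ℝ E]
    [FiniteDimensional ℝ E] [MeasurableSpace E] [BorelSpace E] (μ : Measure E) [μ.IsAddHaarMeasure]
    {r : ℝ} (hr : r ≠ 0) (f : E → ENNReal) :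
    ∫⁻ x, f (r • x) ∂μ = ENNReal.ofReal |(r ^ Module.finrank ℝ E)⁻¹| * ∫⁻ x, f x ∂μ := by
  rw [← smul_eq_mul, ← lintegral_smul_measure, ← Measure.map_addHaar_smul μ hr]
  exact ((MeasurableEquiv.smul₀ r hr).measurableEmbedding.lintegral_map f).symm

/-! ### The Fourier transform on `L¹ ∩ L²`. -/

open FourierTransform SchwartzMap ContDiff in
/-- On `L¹ ∩ L²` the Fourier transform on `L²` is given by the Fourier integral. -/
theorem coeFn_fourier_toLp_ae_eq {E : Type*} [NormedAddCommGroup E] [InnerProductSpace ℝ E]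
    [FiniteDimensional ℝ E] [MeasurableSpace E] [BorelSpace E] {h : E → ℂ}
    (h1 : Integrable h) (h2 : MemLp h 2) :
    ((𝓕 (h2.toLp h) : Lp ℂ 2 (volume : Measure E)) : E → ℂ) =ᵐ[volume] 𝓕 h := by
  have hcont : Continuous (𝓕 h) := VectorFourier.fourierIntegral_continuous
    Real.continuous_fourierChar continuous_inner h1
  have hl1 : LocallyIntegrable
      ((𝓕 (h2.toLp h) : Lp ℂ 2 (volume : Measure E)) : E → ℂ) volume :=
    (Lp.memLp _).locallyIntegrable (by norm_num)
  have hl2 : LocallyIntegrable (𝓕 h) volume := hcont.locallyIntegrable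
  have := ae_eq_zero_of_integral_contDiff_smul_eq_zero (hl1.sub hl2) ?_
  · filter_upwards [this] with x hx using sub_eq_zero.mp hx
  -- Both transforms are paired with a test function `g`; duality moves the transform onto `g`, in
  -- the distributional sense for one and by Fubini for the other.
  intro g hg hgc
  have hg1 : HasCompactSupport (Complex.ofRealCLM ∘ g) := hgc.comp_left rfl
  have hg2 : ContDiff ℝ ∞ (Complex.ofRealCLM ∘ g) := by fun_prop
  set G : 𝓢(E, ℂ) := hg1.toSchwartzMap hg2 with hG
  have hGg : ∀ x, G x = (g x : ℂ) := fun x => rfl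
  have e1 : ∫ x, G x • (𝓕 (h2.toLp h) : Lp ℂ 2 (volume : Measure E)) x = ∫ x, 𝓕 G x • h x := by
    rw [← Lp.toTemperedDistribution_apply, ← Lp.fourier_toTemperedDistribution_eq,
      TemperedDistribution.fourier_apply, Lp.toTemperedDistribution_apply]
    refine integral_congr_ae ?_
    filter_upwards [h2.coeFn_toLp] with x hx
    rw [hx]
  have e2 : ∫ x, 𝓕 G x • h x = ∫ x, G x • 𝓕 h x := by
    have := VectorFourier.integral_fourierIntegral_smul_eq_flip (L := innerₗ E)
      (μ := volume) (ν := volume) Real.continuous_fourierChar continuous_inner G.integrable h1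
    simpa [SchwartzMap.fourier_coe] using! this
  have i1 : Integrable fun x => g x • (𝓕 (h2.toLp h) : Lp ℂ 2 (volume : Measure E)) x :=
    hl1.integrable_smul_left_of_hasCompactSupport hg.continuous hgc
  have i2 : Integrable fun x => g x • 𝓕 h x :=
    hl2.integrable_smul_left_of_hasCompactSupport hg.continuous hgc
  simp only [Pi.sub_apply, smul_sub]
  rw [integral_sub i1 i2, sub_eq_zero]
  simpa [hGg] using e1.trans e2

open FourierTransform in
/-- Plancherel's theorem for functions in `L¹ ∩ L²`. -/
theorem eLpNorm_fourier_eq {E : Type*} [NormedAddCommGroup E] [InnerProductSpace ℝ E]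
    [FiniteDimensional ℝ E] [MeasurableSpace E] [BorelSpace E] {h : E → ℂ}
    (h1 : Integrable h) (h2 : MemLp h 2) :
    eLpNorm (𝓕 h) 2 volume = eLpNorm h 2 volume := by
  rw [← eLpNorm_congr_ae (coeFn_fourier_toLp_ae_eq h1 h2),
    ← eLpNorm_congr_ae h2.coeFn_toLp, ← Lp.enorm_def, ← Lp.enorm_def, ← ofReal_norm,
    ← ofReal_norm, Lp.norm_fourier_eq]

noncomputable section

namespace AngularStrichartz

/-! ### Rotating frames in the plane. -/

/-- The component of `ξ` along the unit vector `(cos α, sin α)`. -/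
def along (α : ℝ) (ξ : Plane) : ℝ := ξ 0 * Real.cos α + ξ 1 * Real.sin α

/-- The component of `ξ` along the unit vector `(-sin α, cos α)`. -/
def across (α : ℝ) (ξ : Plane) : ℝ := ξ 1 * Real.cos α - ξ 0 * Real.sin α

theorem plane_norm_sq (ξ : Plane) : ‖ξ‖ ^ 2 = ξ 0 ^ 2 + ξ 1 ^ 2 := by
  simp [EuclideanSpace.norm_sq_eq]

theorem plane_inner (ξ η : Plane) : inner ℝ ξ η = ξ 0 * η 0 + ξ 1 * η 1 := by
  simp [PiLp.inner_apply, mul_comm]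

theorem along_sq_add_across_sq (α : ℝ) (ξ : Plane) :
    along α ξ ^ 2 + across α ξ ^ 2 = ‖ξ‖ ^ 2 := by
  rw [plane_norm_sq, along, across]
  linear_combination (ξ 0 ^ 2 + ξ 1 ^ 2) * Real.sin_sq_add_cos_sq α

theorem continuous_along : Continuous fun p : ℝ × Plane => along p.1 p.2 := by
  unfold along; fun_prop

theorem continuous_across : Continuous fun p : ℝ × Plane => across p.1 p.2 := by
  unfold across; fun_prop

theorem exists_polar (x y : ℝ) : ∃ φ ∈ Set.Ioc (-Real.pi) Real.pi,
    x = Real.sqrt (x ^ 2 + y ^ 2) * Real.cos φ ∧ y = Real.sqrt (x ^ 2 + y ^ 2) * Real.sin φ := by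
  have hn : ‖(⟨x, y⟩ : ℂ)‖ = Real.sqrt (x ^ 2 + y ^ 2) := by
    rw [Complex.norm_def, Complex.normSq_mk]; ring_nf
  refine ⟨Complex.arg ⟨x, y⟩, Complex.arg_mem_Ioc _, ?_, ?_⟩
  · rw [← hn, Complex.norm_mul_cos_arg]
  · rw [← hn, Complex.norm_mul_sin_arg]

theorem exists_plane_polar (ξ : Plane) : ∃ φ ∈ Set.Ioc (-Real.pi) Real.pi,
    ξ 0 = ‖ξ‖ * Real.cos φ ∧ ξ 1 = ‖ξ‖ * Real.sin φ := by
  have := exists_polar (ξ 0) (ξ 1)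
  rwa [← plane_norm_sq, Real.sqrt_sq (norm_nonneg _)] at this

/-- The zero of the cosine in the interval `[kπ, (k+1)π)` containing `u` lies within `π/2` of `u`,
and there `|cos u| = |sin d|` with `d` the offset, so Jordan's inequality applies. -/
theorem exists_int_abs_sub_le_abs_cos (u : ℝ) :
    |u - ((⌊u / Real.pi⌋ : ℝ) + 1 / 2) * Real.pi| ≤ Real.pi / 2 * |Real.cos u| := by
  have hπ := Real.pi_pos
  set k := ⌊u / Real.pi⌋ with hk
  have h0 : k * Real.pi ≤ u := by
    have := Int.floor_le (u / Real.pi); rwa [← hk, le_div_iff₀ hπ] at this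
  have h1 : u < (k + 1) * Real.pi := by
    have := Int.lt_floor_add_one (u / Real.pi); rwa [← hk, div_lt_iff₀ hπ] at this
  set d := u - ((k : ℝ) + 1 / 2) * Real.pi with hd
  have hu : u = d + Real.pi / 2 + k * Real.pi := by rw [hd]; ring
  have hc : |Real.cos u| = |Real.sin d| := by
    rw [hu, Real.cos_add_int_mul_pi, Real.cos_add_pi_div_two, abs_mul, abs_neg, abs_neg_one_zpow,
      one_mul]
  have hdabs : |d| ≤ Real.pi / 2 := abs_le.mpr ⟨by linarith, by linarith⟩
  have hs := Real.mul_abs_le_abs_sin hdabs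
  rw [hc]
  calc |d| = Real.pi / 2 * (2 / Real.pi * |d|) := by field_simp
    _ ≤ _ := by gcongr

/-- The directions in a bounded interval that are nearly orthogonal to a given vector. -/
theorem volume_abs_along_le {ξ : Plane} (hξ : ξ ≠ 0) (δ : ℝ) :
    volume {α ∈ Set.Ioo (-4 : ℝ) 4 | |along α ξ| ≤ δ * ‖ξ‖} ≤ ENNReal.ofReal (24 * δ) := by
  obtain ⟨φ, hφ, h0, h1⟩ := exists_plane_polar ξ
  have hπ := Real.pi_gt_three
  have hπ' := Real.pi_lt_d2
  -- As `|α| < 4` and `|φ| ≤ π`, the quotient `(α - φ)/π` lies in `(-3, 3)`, which leaves six zeros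
  -- of the cosine. Six intervals of length `4δ` give the constant `24`.
  have hsub : {α ∈ Set.Ioo (-4 : ℝ) 4 | |along α ξ| ≤ δ * ‖ξ‖} ⊆
      ⋃ k ∈ Finset.Icc (-3 : ℤ) 2,
        Metric.closedBall (φ + ((k : ℝ) + 1 / 2) * Real.pi) (2 * δ) := by
    rintro α ⟨⟨ha, hb⟩, hα⟩
    have hc : |Real.cos (α - φ)| ≤ δ := by
      have : along α ξ = ‖ξ‖ * Real.cos (α - φ) := by
        rw [along, h0, h1, Real.cos_sub]; ring
      rw [this, abs_mul, abs_norm, mul_comm] at hα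
      exact le_of_mul_le_mul_right hα (norm_pos_iff.mpr hξ)
    have hk := exists_int_abs_sub_le_abs_cos (α - φ)
    have hp : Real.pi / 2 * |Real.cos (α - φ)| ≤ 2 * δ :=
      mul_le_mul (by linarith) hc (abs_nonneg _) (by norm_num)
    simp only [Set.mem_iUnion, Finset.mem_Icc, Metric.mem_closedBall, Real.dist_eq]
    refine ⟨⌊(α - φ) / Real.pi⌋, ⟨?_, ?_⟩, ?_⟩
    · rw [Int.le_floor, le_div_iff₀ Real.pi_pos]; push_cast; linarith [hφ.2]
    · rw [← Int.lt_add_one_iff, Int.floor_lt, div_lt_iff₀ Real.pi_pos]; push_cast; linarith [hφ.1]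
    · rw [← sub_sub]; exact hk.trans hp
  calc _ ≤ _ := measure_mono hsub
    _ ≤ ∑ k ∈ Finset.Icc (-3 : ℤ) 2,
        volume (Metric.closedBall (φ + ((k : ℝ) + 1 / 2) * Real.pi) (2 * δ)) :=
      measure_biUnion_finset_le _ _
    _ = _ := by
      simp only [Real.volume_closedBall, Finset.sum_const, Int.card_Icc, nsmul_eq_mul]
      rw [← ENNReal.ofReal_natCast, ← ENNReal.ofReal_mul (by positivity)]
      congr 1
      rw [show (2 + 1 - (-3 : ℤ)).toNat = 6 from rfl]
      push_cast
      ring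

/-- The vector `ξ` rotated by a right angle. -/
def rot (ξ : Plane) : Plane := !₂[ξ 1, -ξ 0]

theorem norm_rot (ξ : Plane) : ‖rot ξ‖ = ‖ξ‖ := by
  rw [← sq_eq_sq₀ (norm_nonneg _) (norm_nonneg _), plane_norm_sq, plane_norm_sq]
  simp [rot]; ring

theorem along_rot (α : ℝ) (ξ : Plane) : along α (rot ξ) = across α ξ := by
  simp [rot, along, across]; ring

theorem volume_abs_across_le {ξ : Plane} (hξ : ξ ≠ 0) (δ : ℝ) :
    volume {α ∈ Set.Ioo (-4 : ℝ) 4 | |across α ξ| ≤ δ * ‖ξ‖} ≤ ENNReal.ofReal (24 * δ) := by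
  have h : rot ξ ≠ 0 := by rw [← norm_ne_zero_iff, norm_rot]; simpa
  simpa only [along_rot, norm_rot] using volume_abs_along_le h δ

/-- Nearly orthogonal vectors are nearly aligned with a whole interval of orthogonal frames. -/
theorem ofReal_le_volume_frames {ξ₁ ξ₂ : Plane} {θ : ℝ} (hθ : 0 < θ) (hθ' : θ < 1 / 50)
    (h : |Real.cos (InnerProductGeometry.angle ξ₁ ξ₂)| ≤ θ) :
    ENNReal.ofReal θ ≤ volume {α ∈ Set.Ioo (-4 : ℝ) 4 |
      |across α ξ₁| ≤ θ * ‖ξ₁‖ ∧ |along α ξ₂| ≤ 2 * θ * ‖ξ₂‖} := by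
  have hin : |ξ₁ 0 * ξ₂ 0 + ξ₁ 1 * ξ₂ 1| ≤ θ * (‖ξ₁‖ * ‖ξ₂‖) := by
    rw [← plane_inner, ← InnerProductGeometry.cos_angle_mul_norm_mul_norm, abs_mul,
      abs_of_nonneg (by positivity : 0 ≤ ‖ξ₁‖ * ‖ξ₂‖)]
    gcongr
  have key : ∃ φ ∈ Set.Ioc (-Real.pi) Real.pi, ξ₁ 0 = ‖ξ₁‖ * Real.cos φ ∧
      ξ₁ 1 = ‖ξ₁‖ * Real.sin φ ∧ |along φ ξ₂| ≤ θ * ‖ξ₂‖ := by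
    -- The angle with the zero vector is `π/2`, so this case is allowed by the hypothesis; the
    -- direction is then chosen perpendicular to `ξ₂`.
    by_cases h1 : ξ₁ = 0
    · obtain ⟨φ, hφ, h0, h1'⟩ := exists_plane_polar (rot ξ₂)
      refine ⟨φ, hφ, by simp [h1], by simp [h1], ?_⟩
      rw [norm_rot] at h0 h1'
      simp only [rot, PiLp.toLp_apply, Matrix.cons_val_zero, Matrix.cons_val_one] at h0 h1'
      have : along φ ξ₂ = 0 := by
        rw [along, h0, neg_eq_iff_eq_neg.mp h1']; ring
      rw [this, abs_zero]; positivity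
    · obtain ⟨φ, hφ, h0, h1'⟩ := exists_plane_polar ξ₁
      refine ⟨φ, hφ, h0, h1', ?_⟩
      have : ξ₁ 0 * ξ₂ 0 + ξ₁ 1 * ξ₂ 1 = ‖ξ₁‖ * along φ ξ₂ := by
        rw [along]; rw [h0, h1'] ; ring
      rw [this, abs_mul, abs_norm] at hin
      have hp := norm_pos_iff.mpr h1
      exact le_of_mul_le_mul_left (by linarith) hp
  obtain ⟨φ, hφ, h0, h1, h2⟩ := key
  have hπ' := Real.pi_lt_d2
  -- Turning the frame by at most `θ` away from the direction of `ξ₁` costs one more `θ` in the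
  -- alignment of `ξ₂`, hence the `2 * θ`. The interval `(-4, 4)` leaves room for this beyond `π`.
  have hsub : Set.Icc φ (φ + θ) ⊆ {α ∈ Set.Ioo (-4 : ℝ) 4 |
      |across α ξ₁| ≤ θ * ‖ξ₁‖ ∧ |along α ξ₂| ≤ 2 * θ * ‖ξ₂‖} := by
    rintro α ⟨ha, hb⟩
    have hs : |Real.sin (α - φ)| ≤ θ :=
      (Real.abs_sin_le_abs).trans (by rw [abs_of_nonneg] <;> linarith)
    refine ⟨⟨by linarith [hφ.1], by linarith [hφ.2]⟩, ?_, ?_⟩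
    · have : across α ξ₁ = -(‖ξ₁‖ * Real.sin (α - φ)) := by
        rw [across, h0, h1, Real.sin_sub]; ring
      rw [this, abs_neg, abs_mul, abs_norm, mul_comm]
      gcongr
    · have e : along α ξ₂ = Real.cos (α - φ) * along φ ξ₂ + Real.sin (α - φ) * across φ ξ₂ := by
        obtain ⟨d, rfl⟩ : ∃ d, α = φ + d := ⟨α - φ, by ring⟩
        rw [add_sub_cancel_left, along, along, across, Real.cos_add, Real.sin_add]; ring
      have hac : |across φ ξ₂| ≤ ‖ξ₂‖ :=
        abs_le_of_sq_le_sq (by nlinarith [along_sq_add_across_sq φ ξ₂, sq_nonneg (along φ ξ₂)])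
          (norm_nonneg _)
      calc |along α ξ₂|
          ≤ |Real.cos (α - φ)| * |along φ ξ₂| + |Real.sin (α - φ)| * |across φ ξ₂| := by
            rw [e, ← abs_mul, ← abs_mul]; exact abs_add_le _ _
        _ ≤ 1 * (θ * ‖ξ₂‖) + θ * ‖ξ₂‖ := by
            gcongr; exact Real.abs_cos_le_one _
        _ = _ := by ring
  calc _ = volume (Set.Icc φ (φ + θ)) := by simp
    _ ≤ _ := measure_mono hsub

/-! ### The direction of the half-difference in a fixed frame. -/

/-- Here `(xᵢ, yᵢ)` are the frame coordinates of `ξᵢ`, `rᵢ` is its norm, `s` is `‖ξ₁ + ξ₂‖` and `n`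
is the norm of the half-difference. Near orthogonality makes `n * s` at least `(r₁² + r₂²)/4`, while
each product `xᵢ yᵢ` has one small factor, so the difference is at most `2θ(r₁² + r₂²)`. -/
theorem abs_mul_sub_mul_le {θ x₁ y₁ x₂ y₂ r₁ r₂ s n : ℝ} (hθ : 0 < θ) (hθ' : θ < 1 / 50)
    (p1 : 0 ≤ r₁) (p2 : 0 ≤ r₂) (hs : 0 ≤ s) (hn : 0 ≤ n)
    (n1 : x₁ ^ 2 + y₁ ^ 2 = r₁ ^ 2) (n2 : x₂ ^ 2 + y₂ ^ 2 = r₂ ^ 2)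
    (h1 : |y₁| ≤ θ * r₁) (h2 : |x₂| ≤ 2 * θ * r₂)
    (hsq : s ^ 2 = (x₁ + x₂) ^ 2 + (y₁ + y₂) ^ 2)
    (hnq : 4 * n ^ 2 = (x₁ - x₂) ^ 2 + (y₁ - y₂) ^ 2) :
    |x₁ * y₁ - x₂ * y₂| ≤ 8 * θ * (n * s) ∧ r₁ ^ 2 + r₂ ^ 2 ≤ 2 * s ^ 2 := by
  have bx1 : |x₁| ≤ r₁ := abs_le_of_sq_le_sq (by linarith [sq_nonneg y₁]) p1
  have by2 : |y₂| ≤ r₂ := abs_le_of_sq_le_sq (by linarith [sq_nonneg x₂]) p2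
  have q1 : |x₁ * x₂| ≤ r₁ * (2 * θ * r₂) := by rw [abs_mul]; gcongr
  have q2 : |y₁ * y₂| ≤ (θ * r₁) * r₂ := by rw [abs_mul]; gcongr
  have q3 : |x₁ * y₁| ≤ r₁ * (θ * r₁) := by rw [abs_mul]; gcongr
  have q4 : |x₂ * y₂| ≤ (2 * θ * r₂) * r₂ := by rw [abs_mul]; gcongr
  have hdot : |x₁ * x₂ + y₁ * y₂| ≤ (r₁ ^ 2 + r₂ ^ 2) / 4 := by
    have h3 : θ * (r₁ * r₂) ≤ 1 / 50 * (r₁ * r₂) := by gcongr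
    have h4 : 2 * r₁ * r₂ ≤ r₁ ^ 2 + r₂ ^ 2 := two_mul_le_add_sq r₁ r₂
    linarith [abs_add_le (x₁ * x₂) (y₁ * y₂), sq_nonneg r₁, sq_nonneg r₂]
  obtain ⟨d1, d2⟩ := abs_le.mp hdot
  have l1 : (r₁ ^ 2 + r₂ ^ 2) / 2 ≤ s ^ 2 := by
    have : s ^ 2 = r₁ ^ 2 + r₂ ^ 2 + 2 * (x₁ * x₂ + y₁ * y₂) := by rw [hsq, ← n1, ← n2]; ring
    linarith
  have l2 : (r₁ ^ 2 + r₂ ^ 2) / 8 ≤ n ^ 2 := by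
    have : 4 * n ^ 2 = r₁ ^ 2 + r₂ ^ 2 - 2 * (x₁ * x₂ + y₁ * y₂) := by rw [hnq, ← n1, ← n2]; ring
    linarith
  have l3 : (r₁ ^ 2 + r₂ ^ 2) / 4 ≤ n * s := by
    refine le_of_sq_le_sq ?_ (by positivity)
    calc ((r₁ ^ 2 + r₂ ^ 2) / 4) ^ 2 = (r₁ ^ 2 + r₂ ^ 2) / 8 * ((r₁ ^ 2 + r₂ ^ 2) / 2) := by ring
      _ ≤ n ^ 2 * s ^ 2 := by gcongr
      _ = _ := by ring
  refine ⟨?_, by linarith⟩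
  have l4 : θ * ((r₁ ^ 2 + r₂ ^ 2) / 4) ≤ θ * (n * s) := by gcongr
  have l5 := mul_nonneg hθ.le (sq_nonneg r₁)
  linarith [abs_sub (x₁ * y₁) (x₂ * y₂)]

theorem along_add (α : ℝ) (ξ η : Plane) : along α (ξ + η) = along α ξ + along α η := by
  simp only [along, PiLp.add_apply]; ring

theorem across_add (α : ℝ) (ξ η : Plane) : across α (ξ + η) = across α ξ + across α η := by
  simp only [across, PiLp.add_apply]; ring

theorem along_half_sub (α : ℝ) (ξ η : Plane) :
    along α ((2⁻¹ : ℝ) • (ξ - η)) = (along α ξ - along α η) / 2 := by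
  simp only [along, PiLp.sub_apply, PiLp.smul_apply, smul_eq_mul]; ring

theorem across_half_sub (α : ℝ) (ξ η : Plane) :
    across α ((2⁻¹ : ℝ) • (ξ - η)) = (across α ξ - across α η) / 2 := by
  simp only [across, PiLp.sub_apply, PiLp.smul_apply, smul_eq_mul]; ring

theorem abs_along_mul_across_le {θ : ℝ} (hθ : 0 < θ) (hθ' : θ < 1 / 50) (α : ℝ) (ξ₁ ξ₂ : Plane)
    (h1 : |across α ξ₁| ≤ θ * ‖ξ₁‖) (h2 : |along α ξ₂| ≤ 2 * θ * ‖ξ₂‖) :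
    |along α ξ₁ * across α ξ₁ - along α ξ₂ * across α ξ₂| ≤
        8 * θ * (‖(2⁻¹ : ℝ) • (ξ₁ - ξ₂)‖ * ‖ξ₁ + ξ₂‖) ∧
      ‖ξ₁‖ ^ 2 + ‖ξ₂‖ ^ 2 ≤ 2 * ‖ξ₁ + ξ₂‖ ^ 2 := by
  refine abs_mul_sub_mul_le hθ hθ' (norm_nonneg _) (norm_nonneg _)
    (norm_nonneg _) (norm_nonneg _) (along_sq_add_across_sq α ξ₁) (along_sq_add_across_sq α ξ₂)
    h1 h2 ?_ ?_
  · rw [← along_sq_add_across_sq α, along_add, across_add]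
  · rw [← along_sq_add_across_sq α, along_half_sub, across_half_sub]; ring

/-- If `ξ/2 + η` and `ξ/2 - η` are nearly aligned with the axes of a common frame, then the
direction of `η` is determined by `ξ` up to a small error. -/
theorem exists_direction {θ : ℝ} (hθ : 0 < θ) (hθ' : θ < 1 / 50) (α : ℝ) (ξ : Plane) :
    ∃ m : Plane, m ≠ 0 ∧ ∀ ξ₁ ξ₂ : Plane, ξ₁ + ξ₂ = ξ →
      |across α ξ₁| ≤ θ * ‖ξ₁‖ → |along α ξ₂| ≤ 2 * θ * ‖ξ₂‖ →
      |inner ℝ ((2⁻¹ : ℝ) • (ξ₁ - ξ₂)) m| ≤ 8 * θ * (‖(2⁻¹ : ℝ) • (ξ₁ - ξ₂)‖ * ‖m‖) := by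
  by_cases h : ξ = 0
  · refine ⟨!₂[1, 0], fun h0 => ?_, fun ξ₁ ξ₂ hs h1 h2 => ?_⟩
    · simpa using congrArg (fun v : Plane => v 0) h0
    · have hk := (abs_along_mul_across_le hθ hθ' α ξ₁ ξ₂ h1 h2).2
      rw [hs, h, norm_zero] at hk
      have e1 : ‖ξ₁‖ ^ 2 = 0 := by linarith [sq_nonneg ‖ξ₁‖, sq_nonneg ‖ξ₂‖]
      have e2 : ‖ξ₂‖ ^ 2 = 0 := by linarith [sq_nonneg ‖ξ₁‖, sq_nonneg ‖ξ₂‖]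
      rw [norm_eq_zero.mp (pow_eq_zero_iff two_ne_zero |>.mp e1),
        norm_eq_zero.mp (pow_eq_zero_iff two_ne_zero |>.mp e2)]
      simp
  -- `m` is `ξ` reflected in the diagonal of the frame. With exact alignment `ξ = (x, y)` and `η =
  -- (x, -y)/2`, so `m = (y, x)` is orthogonal to `η`; in general `⟪η, m⟫ = x₁ y₁ - x₂ y₂`.
  · set m : Plane := !₂[Real.cos α * across α ξ - Real.sin α * along α ξ,
      Real.sin α * across α ξ + Real.cos α * along α ξ] with hm
    have hm0 : m 0 = Real.cos α * across α ξ - Real.sin α * along α ξ := rfl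
    have hm1 : m 1 = Real.sin α * across α ξ + Real.cos α * along α ξ := rfl
    have hmn : ‖m‖ = ‖ξ‖ := by
      rw [← sq_eq_sq₀ (norm_nonneg _) (norm_nonneg _), plane_norm_sq,
        ← along_sq_add_across_sq α ξ, hm0, hm1]
      linear_combination (along α ξ ^ 2 + across α ξ ^ 2) * Real.sin_sq_add_cos_sq α
    refine ⟨m, by rw [← norm_ne_zero_iff, hmn]; simpa, fun ξ₁ ξ₂ hs h1 h2 => ?_⟩
    have hi : ∀ η : Plane, inner ℝ η m = along α η * across α ξ + across α η * along α ξ := by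
      intro η
      rw [plane_inner, hm0, hm1]
      simp only [along, across]; ring
    have hk := (abs_along_mul_across_le hθ hθ' α ξ₁ ξ₂ h1 h2).1
    rw [hmn, hi, ← hs, along_half_sub, across_half_sub, along_add, across_add]
    refine le_trans (le_of_eq ?_) hk
    congr 1
    ring

/-! ### Integration over narrow sectors. -/

theorem volume_preserving_plane :
    MeasurePreserving (fun p : ℝ × ℝ => (!₂[p.1, p.2] : Plane)) := by
  have h := (PiLp.volume_preserving_toLp (Fin 2)).comp (volume_preserving_finTwoArrow ℝ).symm
  exact h

/-- Substituting `u = r²` turns the planar area element into `du/2`; this is why the sector bound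
does not depend on the size of the frequencies. -/
theorem lintegral_ofReal_mul_comp_sq_le (g : ℝ → ENNReal) :
    ∫⁻ r in Set.Ioi (0 : ℝ), ENNReal.ofReal r * g (r ^ 2) ≤ ∫⁻ u, g u := by
  have h := lintegral_image_eq_lintegral_abs_deriv_mul (s := Set.Ioi (0 : ℝ))
    (f := fun r : ℝ => r ^ 2) (f' := fun r => 2 * r) measurableSet_Ioi
    (fun x _ => by simpa using (hasDerivAt_pow 2 x).hasDerivWithinAt)
    (fun x hx y hy hxy => by
      exact (sq_eq_sq₀ (le_of_lt hx) (le_of_lt hy)).mp hxy) g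
  refine le_trans (lintegral_mono_ae ?_) (h.symm.le.trans (setLIntegral_le_lintegral _ _))
  refine Filter.Eventually.of_forall fun r => ?_
  gcongr
  linarith [le_abs_self (2 * r), abs_nonneg (2 * r)]

/-- The integral of a radial function over a narrow double sector. -/
theorem lintegral_sector_le {m : Plane} (hm : m ≠ 0) (δ : ℝ) {g : ℝ → ENNReal}
    (hg : Measurable g) :
    ∫⁻ η : Plane, {η : Plane | |inner ℝ η m| ≤ δ * (‖η‖ * ‖m‖)}.indicator
        (fun η => g (‖η‖ ^ 2)) η ≤ ENNReal.ofReal (24 * δ) * ∫⁻ u, g u := by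
  have hS : MeasurableSet {η : Plane | |inner ℝ η m| ≤ δ * (‖η‖ * ‖m‖)} :=
    measurableSet_le (by fun_prop) (by fun_prop)
  have hI : Measurable ({η : Plane | |inner ℝ η m| ≤ δ * (‖η‖ * ‖m‖)}.indicator
      (fun η => g (‖η‖ ^ 2))) := Measurable.indicator (by fun_prop) hS
  set A : Set ℝ := {α ∈ Set.Ioo (-4 : ℝ) 4 | |along α m| ≤ δ * ‖m‖} with hA
  have hAm : MeasurableSet A := measurableSet_Ioo.inter (measurableSet_le
    ((continuous_along.comp (Continuous.prodMk_left m)).measurable.abs) measurable_const)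
  rw [← volume_preserving_plane.lintegral_comp hI, ← lintegral_comp_polarCoord_symm]
  -- In polar coordinates `⟪η, m⟫ = r * along α m`, so membership in the sector is a condition on
  -- the angle alone and the integral factors.
  calc _ ≤ ∫⁻ p in Set.Ioi (0 : ℝ) ×ˢ Set.Ioo (-Real.pi) Real.pi,
        (ENNReal.ofReal p.1 * g (p.1 ^ 2)) * A.indicator (fun _ => 1) p.2 := by
        refine setLIntegral_mono' (measurableSet_Ioi.prod measurableSet_Ioo) ?_
        rintro ⟨r, α⟩ ⟨hr, hα⟩
        simp only [Set.mem_Ioi] at hr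
        rw [smul_eq_mul, mul_assoc]
        gcongr
        set η : Plane := !₂[(polarCoord.symm (r, α)).1, (polarCoord.symm (r, α)).2] with hη
        have hη0 : η 0 = r * Real.cos α := rfl
        have hη1 : η 1 = r * Real.sin α := rfl
        have hn : ‖η‖ = r := by
          rw [← sq_eq_sq₀ (norm_nonneg _) hr.le, plane_norm_sq, hη0, hη1]
          linear_combination r ^ 2 * Real.sin_sq_add_cos_sq α
        by_cases hmem : η ∈ {η : Plane | |inner ℝ η m| ≤ δ * (‖η‖ * ‖m‖)}
        · rw [Set.indicator_of_mem hmem, hn, Set.indicator_of_mem, mul_one]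
          have hi : inner ℝ η m = r * along α m := by
            rw [plane_inner, hη0, hη1, along]; ring
          rw [Set.mem_ofPred_eq, hi, hn, abs_mul, abs_of_pos hr] at hmem
          have h3 := Real.pi_lt_d2
          exact ⟨⟨by linarith [hα.1], by linarith [hα.2]⟩,
            le_of_mul_le_mul_left (by linarith) hr⟩
        · rw [Set.indicator_of_notMem hmem]; exact zero_le
    _ = (∫⁻ r in Set.Ioi (0 : ℝ), ENNReal.ofReal r * g (r ^ 2)) *
        ∫⁻ α in Set.Ioo (-Real.pi) Real.pi, A.indicator (fun _ => 1) α := by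
        rw [Measure.volume_eq_prod, ← Measure.prod_restrict]
        exact lintegral_prod_mul (f := fun r => ENNReal.ofReal r * g (r ^ 2)) (by fun_prop)
          (measurable_const.indicator hAm).aemeasurable
    _ ≤ (∫⁻ u, g u) * ENNReal.ofReal (24 * δ) := by
        refine mul_le_mul' (lintegral_ofReal_mul_comp_sq_le g) ?_
        refine (setLIntegral_le_lintegral _ _).trans ?_
        rw [lintegral_indicator hAm, setLIntegral_one]
        exact volume_abs_along_le hm δ
    _ = _ := mul_comm _ _

/-- The frequencies nearly aligned with the first axis of the frame at angle `α`. -/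
def alignedFirst (θ : ℝ) : Set (ℝ × Plane) := {p | |across p.1 p.2| ≤ θ * ‖p.2‖}

/-- The frequencies nearly aligned with the second axis of the frame at angle `α`. -/
def alignedSecond (θ : ℝ) : Set (ℝ × Plane) := {p | |along p.1 p.2| ≤ 2 * θ * ‖p.2‖}

theorem measurableSet_alignedFirst (θ : ℝ) : MeasurableSet (alignedFirst θ) :=
  measurableSet_le continuous_across.measurable.abs (by fun_prop)

theorem measurableSet_alignedSecond (θ : ℝ) : MeasurableSet (alignedSecond θ) :=
  measurableSet_le continuous_along.measurable.abs (by fun_prop)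

/-- After centring at `ξ/2`, the parallelogram law makes the argument of `g` a function of `‖η‖²`,
and `exists_direction` confines `η` to a sector of aperture `8θ`; thus `192 = 24 * 8`. -/
theorem lintegral_aligned_le {θ : ℝ} (hθ : 0 < θ) (hθ' : θ < 1 / 50) (α : ℝ) (ξ : Plane)
    {g : ℝ → ENNReal} (hg : Measurable g) :
    ∫⁻ ξ₁ : Plane, (alignedFirst θ).indicator 1 (α, ξ₁) *
        (alignedSecond θ).indicator 1 (α, ξ - ξ₁) * g (‖ξ₁‖ ^ 2 + ‖ξ - ξ₁‖ ^ 2) ≤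
      ENNReal.ofReal (192 * θ) * ∫⁻ u, g u := by
  obtain ⟨m, hm, hdir⟩ := exists_direction hθ hθ' α ξ
  set g' : ℝ → ENNReal := fun u => g (‖ξ‖ ^ 2 / 2 + (2 : ℝ) • u) with hg'
  have hg'm : Measurable g' := by
    rw [hg']; exact hg.comp (by fun_prop)
  have hgi : ∫⁻ u, g' u ≤ ∫⁻ u, g u := by
    rw [hg', lintegral_comp_smul volume two_ne_zero (fun u => g (‖ξ‖ ^ 2 / 2 + u)),
      lintegral_add_left_eq_self]
    refine mul_le_of_le_one_left zero_le ?_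
    rw [ENNReal.ofReal_le_one, Module.finrank_self]
    norm_num
  rw [← lintegral_add_left_eq_self _ ((2⁻¹ : ℝ) • ξ)]
  calc _ ≤ ∫⁻ η : Plane, {η : Plane | |inner ℝ η m| ≤ (8 * θ) * (‖η‖ * ‖m‖)}.indicator
        (fun η => g' (‖η‖ ^ 2)) η := by
        refine lintegral_mono fun η => ?_
        have hd : ξ - ((2⁻¹ : ℝ) • ξ + η) = (2⁻¹ : ℝ) • ξ - η := by module
        have hs : ((2⁻¹ : ℝ) • ξ + η) + ((2⁻¹ : ℝ) • ξ - η) = ξ := by module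
        have hη : (2⁻¹ : ℝ) • (((2⁻¹ : ℝ) • ξ + η) - ((2⁻¹ : ℝ) • ξ - η)) = η := by module
        have hp := parallelogram_law_with_norm ℝ ((2⁻¹ : ℝ) • ξ) η
        have hx : ‖(2⁻¹ : ℝ) • ξ‖ = ‖ξ‖ / 2 := by rw [norm_smul]; norm_num; ring
        have hn : ‖(2⁻¹ : ℝ) • ξ + η‖ ^ 2 + ‖(2⁻¹ : ℝ) • ξ - η‖ ^ 2 =
            ‖ξ‖ ^ 2 / 2 + (2 : ℝ) • ‖η‖ ^ 2 := by
          rw [hx] at hp; rw [smul_eq_mul]; linarith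
        rw [hd, hn]
        by_cases h1 : (α, (2⁻¹ : ℝ) • ξ + η) ∈ alignedFirst θ
        · by_cases h2 : (α, (2⁻¹ : ℝ) • ξ - η) ∈ alignedSecond θ
          · have := hdir _ _ hs h1 h2
            rw [hη] at this
            rw [Set.indicator_of_mem h1, Set.indicator_of_mem h2,
              Set.indicator_of_mem (s := {η : Plane | |inner ℝ η m| ≤ (8 * θ) * (‖η‖ * ‖m‖)}) this]
            simp [hg']
          · simp [Set.indicator_of_notMem h2]
        · simp [Set.indicator_of_notMem h1]
    _ ≤ ENNReal.ofReal (24 * (8 * θ)) * ∫⁻ u, g' u := lintegral_sector_le hm _ hg'm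
    _ ≤ _ := by
        rw [← mul_assoc]; norm_num; gcongr

/-! ### Modulation weights. -/

/-- The weight `⟨s⟩^{-b}`. -/
def weight (b s : ℝ) : ENNReal := ENNReal.ofReal (bracket s ^ (-b))

theorem measurable_weight (b : ℝ) : Measurable (weight b) := by
  unfold weight bracket; fun_prop

theorem one_le_bracket {V : Type*} [NormedAddCommGroup V] (y : V) : 1 ≤ bracket y :=
  Real.one_le_sqrt.mpr (by nlinarith [sq_nonneg ‖y‖])

theorem weight_anti {b : ℝ} (hb : 0 ≤ b) {s t : ℝ} (h : |s| ≤ |t|) : weight b t ≤ weight b s := by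
  refine ENNReal.ofReal_le_ofReal (Real.rpow_le_rpow_of_nonpos ?_ ?_ (by linarith))
  · linarith [one_le_bracket s]
  · unfold bracket
    simp only [Real.norm_eq_abs]
    gcongr

theorem lintegral_weight_sq_lt_top {b : ℝ} (hb : 1 / 2 < b) : ∫⁻ s, weight b s ^ 2 < ⊤ := by
  have h := (integrable_rpow_neg_one_add_norm_sq (E := ℝ) (μ := volume) (r := 2 * b)
    (by simp; linarith)).lintegral_lt_top
  convert h using 3 with s
  rw [weight, ← ENNReal.ofReal_pow (Real.rpow_nonneg (by linarith [one_le_bracket s]) _), bracket,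
    ← Real.rpow_natCast, ← Real.rpow_mul (Real.sqrt_nonneg _), Real.sqrt_eq_rpow,
    ← Real.rpow_mul (by positivity)]
  congr 2
  push_cast; ring

/-- One of `|x|`, `|y|` is at least half of `|x + y|`, so its weight is controlled by the sum. -/
theorem weight_mul_sq_le {b : ℝ} (hb : 0 ≤ b) (x y : ℝ) :
    (weight b x * weight b y) ^ 2 ≤
      weight b ((2 : ℝ)⁻¹ • (x + y)) ^ 2 * (weight b x ^ 2 + weight b y ^ 2) := by
  rw [mul_pow]
  rcases le_total |x| |y| with h | h
  · have : weight b y ≤ weight b ((2 : ℝ)⁻¹ • (x + y)) := weight_anti hb (by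
      rw [smul_eq_mul, abs_mul, abs_of_pos (by norm_num : (0 : ℝ) < 2⁻¹)]
      linarith [abs_add_le x y])
    rw [mul_comm]
    gcongr
    exact le_self_add
  · have : weight b x ≤ weight b ((2 : ℝ)⁻¹ • (x + y)) := weight_anti hb (by
      rw [smul_eq_mul, abs_mul, abs_of_pos (by norm_num : (0 : ℝ) < 2⁻¹)]
      linarith [abs_add_le x y])
    gcongr
    exact le_add_self

theorem lintegral_weight_mul_sq_le {b : ℝ} (hb : 0 ≤ b) (p q τ : ℝ) :
    ∫⁻ τ₁, (weight b (τ₁ + p) * weight b (τ - τ₁ + q)) ^ 2 ≤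
      weight b ((2 : ℝ)⁻¹ • (τ + (p + q))) ^ 2 * (2 * ∫⁻ s, weight b s ^ 2) := by
  have hw := measurable_weight b
  have e : ∀ τ₁, (τ₁ + p) + (τ - τ₁ + q) = τ + (p + q) := fun _ => by ring
  refine (lintegral_mono fun τ₁ => (weight_mul_sq_le hb _ _)).trans ?_
  simp only [e]
  rw [lintegral_const_mul _ (by fun_prop), lintegral_add_left (by fun_prop),
    lintegral_add_right_eq_self (fun s => weight b s ^ 2), two_mul]
  refine mul_le_mul' le_rfl (add_le_add le_rfl (le_of_eq ?_))
  have : ∀ τ₁, τ - τ₁ + q = (τ + q) - τ₁ := fun _ => by ring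
  simp only [this]
  rw [lintegral_sub_left_eq_self (fun s => weight b s ^ 2)]

/-- The weight of `X^{0,-b}` on spacetime. -/
def dispersiveWeight (b : ℝ) (ζ : Spacetime) : ENNReal := weight b (ζ.fst + ‖ζ.snd‖ ^ 2)

theorem measurable_dispersiveWeight (b : ℝ) : Measurable (dispersiveWeight b) :=
  (measurable_weight b).comp (by fun_prop)

theorem lintegral_spacetime {f : Spacetime → ENNReal} (hf : Measurable f) :
    ∫⁻ ζ, f ζ = ∫⁻ ξ : Plane, ∫⁻ τ : ℝ, f (WithLp.toLp 2 (τ, ξ)) := by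
  have h := WithLp.volume_preserving_toLp ℝ Plane
  rw [← h.lintegral_comp hf, Measure.volume_eq_prod,
    lintegral_prod_symm _ (by exact (hf.comp h.measurable).aemeasurable)]

/-- This is the fibrewise hypothesis of `lintegral_convolution_sq_le`. The `τ` integral leaves a
weight in the resonance function, which `lintegral_aligned_le` integrates over the sector. The
factor `4` is `2` from the `τ` integral and `2` from rescaling the remaining weight. -/
theorem lintegral_aligned_weight_le {b : ℝ} (hb : 0 ≤ b) {θ : ℝ} (hθ : 0 < θ)
    (hθ' : θ < 1 / 50) (α : ℝ) (ζ : Spacetime) :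
    ∫⁻ ζ₁ : Spacetime, (((alignedFirst θ).indicator 1 (α, ζ₁.snd) * dispersiveWeight b ζ₁) *
        ((alignedSecond θ).indicator 1 (α, (ζ - ζ₁).snd) * dispersiveWeight b (ζ - ζ₁))) ^ 2 ≤
      ENNReal.ofReal (192 * θ) * (4 * (∫⁻ s, weight b s ^ 2) ^ 2) := by
  have hw := measurable_dispersiveWeight b
  have hw' := measurable_weight b
  have hF : Measurable ((alignedFirst θ).indicator (1 : ℝ × Plane → ENNReal)) :=
    measurable_one.indicator (measurableSet_alignedFirst θ)
  have hS : Measurable ((alignedSecond θ).indicator (1 : ℝ × Plane → ENNReal)) :=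
    measurable_one.indicator (measurableSet_alignedSecond θ)
  have hi : ∀ (s : Set (ℝ × Plane)) p,
      (s.indicator (1 : ℝ × Plane → ENNReal) p) ^ 2 = s.indicator 1 p := fun s p => by
    by_cases h : p ∈ s <;> simp [h]
  set Ω := ∫⁻ s, weight b s ^ 2 with hΩ
  rw [lintegral_spacetime (by fun_prop)]
  calc _ ≤ ∫⁻ ξ₁ : Plane, (alignedFirst θ).indicator 1 (α, ξ₁) *
        (alignedSecond θ).indicator 1 (α, ζ.snd - ξ₁) *
        (weight b ((2 : ℝ)⁻¹ • (ζ.fst + (‖ξ₁‖ ^ 2 + ‖ζ.snd - ξ₁‖ ^ 2))) ^ 2 * (2 * Ω)) := by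
        refine lintegral_mono fun ξ₁ => ?_
        refine le_trans (le_of_eq ?_) (mul_le_mul_right
          (lintegral_weight_mul_sq_le hb (‖ξ₁‖ ^ 2) (‖ζ.snd - ξ₁‖ ^ 2) ζ.fst) _)
        rw [← lintegral_const_mul _ (by fun_prop)]
        refine lintegral_congr fun τ => ?_
        simp only [mul_pow, hi, dispersiveWeight, WithLp.sub_fst, WithLp.sub_snd,
          WithLp.toLp_fst, WithLp.toLp_snd]
        ring
    _ ≤ _ := lintegral_aligned_le hθ hθ' α ζ.snd
        (g := fun u => weight b ((2 : ℝ)⁻¹ • (ζ.fst + u)) ^ 2 * (2 * Ω)) (by fun_prop)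
    _ = _ := by
        congr 1
        rw [lintegral_mul_const _ (by fun_prop),
          lintegral_add_left_eq_self (fun u => weight b ((2 : ℝ)⁻¹ • u) ^ 2),
          lintegral_comp_smul volume (by norm_num) (fun u => weight b u ^ 2), ← hΩ,
          Module.finrank_self]
        norm_num
        ring

/-! ### Averaging over frames. -/

/-- The pairs of frequencies whose angle is nearly a right angle. -/
def nearlyOrthogonal (θ : ℝ) : Set (Plane × Plane) :=
  {p | |Real.cos (InnerProductGeometry.angle p.1 p.2)| ≤ θ}

theorem measurableSet_nearlyOrthogonal (θ : ℝ) : MeasurableSet (nearlyOrthogonal θ) := by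
  have : Measurable fun p : Plane × Plane => InnerProductGeometry.angle p.1 p.2 := by
    unfold InnerProductGeometry.angle; fun_prop
  exact measurableSet_le (Real.measurable_cos.comp this).abs measurable_const

theorem measurable_indicator_first (θ : ℝ) :
    Measurable ((alignedFirst θ).indicator (1 : ℝ × Plane → ENNReal)) :=
  measurable_one.indicator (measurableSet_alignedFirst θ)

theorem measurable_indicator_second (θ : ℝ) :
    Measurable ((alignedSecond θ).indicator (1 : ℝ × Plane → ENNReal)) :=
  measurable_one.indicator (measurableSet_alignedSecond θ)

/-- The cut-off coupling both frequencies is dominated by a superposition of products of cut-offs in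
each frequency separately. -/
theorem indicator_nearlyOrthogonal_le {θ : ℝ} (hθ : 0 < θ) (hθ' : θ < 1 / 50) (ξ₁ ξ₂ : Plane) :
    ENNReal.ofReal θ * (nearlyOrthogonal θ).indicator 1 (ξ₁, ξ₂) ≤
      ∫⁻ α in Set.Ioo (-4 : ℝ) 4,
        (alignedFirst θ).indicator 1 (α, ξ₁) * (alignedSecond θ).indicator 1 (α, ξ₂) := by
  by_cases h : (ξ₁, ξ₂) ∈ nearlyOrthogonal θ
  · rw [Set.indicator_of_mem h, Pi.one_apply, mul_one]
    set A : Set ℝ := {α | |across α ξ₁| ≤ θ * ‖ξ₁‖ ∧ |along α ξ₂| ≤ 2 * θ * ‖ξ₂‖} with hA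
    have hAm : MeasurableSet A :=
      ((measurableSet_alignedFirst θ).preimage (by fun_prop : Measurable fun α : ℝ => (α, ξ₁))).inter
        ((measurableSet_alignedSecond θ).preimage (by fun_prop : Measurable fun α : ℝ => (α, ξ₂)))
    calc ENNReal.ofReal θ ≤ volume (Set.Ioo (-4 : ℝ) 4 ∩ A) := ofReal_le_volume_frames hθ hθ' h
      _ = ∫⁻ α in Set.Ioo (-4 : ℝ) 4, A.indicator 1 α := by
          rw [lintegral_indicator_one hAm, Measure.restrict_apply hAm, Set.inter_comm]
      _ = _ := lintegral_congr fun α => by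
          have hAiff : α ∈ A ↔ (α, ξ₁) ∈ alignedFirst θ ∧ (α, ξ₂) ∈ alignedSecond θ := Iff.rfl
          by_cases h1 : (α, ξ₁) ∈ alignedFirst θ <;> by_cases h2 : (α, ξ₂) ∈ alignedSecond θ <;>
            simp [Set.indicator, hAiff, h1, h2]
  · simp [Set.indicator_of_notMem h]

/-- The zero spatial frequency is aligned with every frame, so it must be discarded before the
measure bounds in `α` apply. -/
theorem ae_snd_ne_zero : ∀ᵐ ζ : Spacetime, ζ.snd ≠ 0 := by
  set p : Submodule ℝ Spacetime := LinearMap.ker (WithLp.sndL 2 ℝ ℝ Plane : Spacetime →ₗ[ℝ] Plane)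
  have hp : p ≠ ⊤ := fun h => by
    have : (WithLp.toLp 2 ((0 : ℝ), (!₂[1, 0] : Plane)) : Spacetime) ∈ p := h ▸ trivial
    have h' : (!₂[1, 0] : Plane) = 0 := this
    simpa using congrArg (fun v : Plane => v 0) h'
  exact measure_mono_null (fun ζ hζ => not_not.mp hζ) (Measure.addHaar_submodule volume p hp)

/-- Averaging over all frames localizes in angle. -/
theorem lintegral_lintegral_aligned_le {s : Set (ℝ × Plane)} (hs : MeasurableSet s) {c : ENNReal}
    (hc : ∀ ξ : Plane, ξ ≠ 0 → volume {α ∈ Set.Ioo (-4 : ℝ) 4 | (α, ξ) ∈ s} ≤ c)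
    {F : Spacetime → ENNReal} (hF : Measurable F) :
    ∫⁻ α in Set.Ioo (-4 : ℝ) 4, ∫⁻ ζ, (s.indicator 1 (α, ζ.snd) * F ζ) ^ 2 ≤
      c * ∫⁻ ζ, F ζ ^ 2 := by
  have hsm : Measurable (s.indicator (1 : ℝ × Plane → ENNReal)) := measurable_one.indicator hs
  rw [lintegral_lintegral_swap (by fun_prop), ← lintegral_const_mul _ (by fun_prop)]
  refine lintegral_mono_ae ?_
  filter_upwards [ae_snd_ne_zero] with ζ hζ
  have hm : MeasurableSet {α : ℝ | (α, ζ.snd) ∈ s} :=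
    hs.preimage (by fun_prop : Measurable fun α : ℝ => (α, ζ.snd))
  calc _ = ∫⁻ α in Set.Ioo (-4 : ℝ) 4, {α : ℝ | (α, ζ.snd) ∈ s}.indicator 1 α * F ζ ^ 2 :=
        lintegral_congr fun α => by
          by_cases h : (α, ζ.snd) ∈ s <;> simp [Set.indicator, h]
    _ = volume {α ∈ Set.Ioo (-4 : ℝ) 4 | (α, ζ.snd) ∈ s} * F ζ ^ 2 := by
        rw [lintegral_mul_const _ (measurable_one.indicator hm), lintegral_indicator_one hm,
          Measure.restrict_apply hm, Set.inter_comm]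
        rfl
    _ ≤ _ := by gcongr; exact hc _ hζ

/-! ### The bilinear estimate on the Fourier side. -/

/-- The part of the bilinear interaction aligned with the frame at angle `α`. -/
def alignedConvolution (b θ : ℝ) (F G : Spacetime → ENNReal) (α : ℝ) (ζ : Spacetime) : ENNReal :=
  ∫⁻ x : Spacetime,
    (((alignedFirst θ).indicator 1 (α, x.snd) * dispersiveWeight b x) *
      ((alignedFirst θ).indicator 1 (α, x.snd) * F x)) *
    (((alignedSecond θ).indicator 1 (α, (ζ - x).snd) * dispersiveWeight b (ζ - x)) *
      ((alignedSecond θ).indicator 1 (α, (ζ - x).snd) * G (ζ - x)))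

/-- The angularly restricted bilinear interaction on the Fourier side. -/
def angularConvolution (b θ : ℝ) (F G : Spacetime → ENNReal) (ζ : Spacetime) : ENNReal :=
  ∫⁻ x : Spacetime, (nearlyOrthogonal θ).indicator 1 (x.snd, (ζ - x).snd) *
    ((dispersiveWeight b x * F x) * (dispersiveWeight b (ζ - x) * G (ζ - x)))

theorem measurable_alignedConvolution (b θ : ℝ) {F G : Spacetime → ENNReal} (hF : Measurable F)
    (hG : Measurable G) : Measurable (Function.uncurry (alignedConvolution b θ F G)) := by
  have hw := measurable_dispersiveWeight b
  have h1 := measurable_indicator_first θ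
  have h2 := measurable_indicator_second θ
  refine Measurable.lintegral_prod_right' (f := fun p : (ℝ × Spacetime) × Spacetime =>
    (((alignedFirst θ).indicator 1 (p.1.1, p.2.snd) * dispersiveWeight b p.2) *
      ((alignedFirst θ).indicator 1 (p.1.1, p.2.snd) * F p.2)) *
    (((alignedSecond θ).indicator 1 (p.1.1, (p.1.2 - p.2).snd) * dispersiveWeight b (p.1.2 - p.2)) *
      ((alignedSecond θ).indicator 1 (p.1.1, (p.1.2 - p.2).snd) * G (p.1.2 - p.2)))) ?_
  fun_prop

/-- Cut-offs are idempotent, so each may appear twice in `alignedConvolution`: one copy restricts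
the weight for the sector bound, the other restricts the function for the average over `α`. -/
theorem ofReal_mul_angularConvolution_le (b : ℝ) {θ : ℝ} (hθ : 0 < θ) (hθ' : θ < 1 / 50)
    {F G : Spacetime → ENNReal} (hF : Measurable F) (hG : Measurable G) (ζ : Spacetime) :
    ENNReal.ofReal θ * angularConvolution b θ F G ζ ≤
      ∫⁻ α in Set.Ioo (-4 : ℝ) 4, alignedConvolution b θ F G α ζ := by
  have hw := measurable_dispersiveWeight b
  have h1 := measurable_indicator_first θ
  have h2 := measurable_indicator_second θ
  have h3 : Measurable ((nearlyOrthogonal θ).indicator (1 : Plane × Plane → ENNReal)) :=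
    measurable_one.indicator (measurableSet_nearlyOrthogonal θ)
  unfold alignedConvolution angularConvolution
  rw [lintegral_lintegral_swap (by fun_prop), ← lintegral_const_mul _ (by fun_prop)]
  refine lintegral_mono fun x => ?_
  rw [← mul_assoc]
  refine (mul_le_mul_left (indicator_nearlyOrthogonal_le hθ hθ' _ _) _).trans (le_of_eq ?_)
  rw [← lintegral_mul_const _ (by fun_prop)]
  refine lintegral_congr fun α => ?_
  by_cases k1 : (α, x.snd) ∈ alignedFirst θ
  · by_cases k2 : (α, (ζ - x).snd) ∈ alignedSecond θ
    · simp only [Set.indicator_of_mem k1, Set.indicator_of_mem k2, Pi.one_apply, one_mul]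
    · simp only [Set.indicator_of_notMem k2, zero_mul, mul_zero]
  · simp only [Set.indicator_of_notMem k1, zero_mul]

/-- The bilinear estimate on the Fourier side. -/
theorem lintegral_angularConvolution_sq_le {b : ℝ} (hb : 0 ≤ b) {θ : ℝ} (hθ : 0 < θ)
    (hθ' : θ < 1 / 50) {F G : Spacetime → ENNReal} (hF : Measurable F) (hG : Measurable G) :
    ∫⁻ ζ, angularConvolution b θ F G ζ ^ 2 ≤
      ENNReal.ofReal θ * (884736 * (∫⁻ s, weight b s ^ 2) ^ 2) *
        ((∫⁻ ζ, F ζ ^ 2) * ∫⁻ ζ, G ζ ^ 2) := by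
  have hw := measurable_dispersiveWeight b
  have h1 := measurable_indicator_first θ
  have h2 := measurable_indicator_second θ
  have hm := measurable_alignedConvolution b θ hF hG
  set Ω := ∫⁻ s, weight b s ^ 2
  set K := ENNReal.ofReal (192 * θ) * (4 * Ω ^ 2) with hK
  set t := ENNReal.ofReal θ with ht
  have ht0 : t ≠ 0 := by rw [ht]; simpa using hθ
  have htop : t ≠ ⊤ := ENNReal.ofReal_ne_top
  have step : ∀ α, ∫⁻ ζ, alignedConvolution b θ F G α ζ ^ 2 ≤
      K * ((∫⁻ x : Spacetime, ((alignedFirst θ).indicator 1 (α, x.snd) * F x) ^ 2) *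
        ∫⁻ x : Spacetime, ((alignedSecond θ).indicator 1 (α, x.snd) * G x) ^ 2) := fun α =>
    lintegral_convolution_sq_le
      (a := fun x : Spacetime => (alignedFirst θ).indicator 1 (α, x.snd) * dispersiveWeight b x)
      (b := fun x : Spacetime => (alignedSecond θ).indicator 1 (α, x.snd) * dispersiveWeight b x)
      (f := fun x : Spacetime => (alignedFirst θ).indicator 1 (α, x.snd) * F x)
      (g := fun x : Spacetime => (alignedSecond θ).indicator 1 (α, x.snd) * G x)
      (by fun_prop) (by fun_prop) (by fun_prop) (by fun_prop)
      (fun ζ => lintegral_aligned_weight_le hb hθ hθ' α ζ)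
  -- The factor `θ²` comes from the frame average and is cancelled at the end, against `θ³` on the
  -- right.
  have main : t ^ 2 * ∫⁻ ζ, angularConvolution b θ F G ζ ^ 2 ≤
      t ^ 2 * (t * (884736 * Ω ^ 2) * ((∫⁻ ζ, F ζ ^ 2) * ∫⁻ ζ, G ζ ^ 2)) := by
    calc t ^ 2 * ∫⁻ ζ, angularConvolution b θ F G ζ ^ 2
        = ∫⁻ ζ, (t * angularConvolution b θ F G ζ) ^ 2 := by
          simp_rw [mul_pow]
          rw [lintegral_const_mul' _ _ (ENNReal.pow_ne_top htop)]
      _ ≤ ∫⁻ ζ, (∫⁻ α in Set.Ioo (-4 : ℝ) 4, alignedConvolution b θ F G α ζ) ^ 2 := by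
          gcongr with ζ
          exact ofReal_mul_angularConvolution_le b hθ hθ' hF hG ζ
      _ ≤ (∫⁻ α in Set.Ioo (-4 : ℝ) 4,
          (∫⁻ ζ, alignedConvolution b θ F G α ζ ^ 2) ^ (1 / 2 : ℝ)) ^ 2 :=
          lintegral_lintegral_sq_le hm
      _ ≤ (∫⁻ α in Set.Ioo (-4 : ℝ) 4,
          ((K * ∫⁻ x : Spacetime, ((alignedFirst θ).indicator 1 (α, x.snd) * F x) ^ 2) *
            ∫⁻ x : Spacetime, ((alignedSecond θ).indicator 1 (α, x.snd) * G x) ^ 2) ^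
              (1 / 2 : ℝ)) ^ 2 := by
          gcongr with α
          rw [mul_assoc]
          exact step α
      _ ≤ _ := lintegral_sqrt_mul_sq_le
          (((Measurable.lintegral_prod_right' (f := fun p : ℝ × Spacetime =>
            ((alignedFirst θ).indicator 1 (p.1, p.2.snd) * F p.2) ^ 2)
              (by fun_prop)).const_mul K).aemeasurable)
          ((Measurable.lintegral_prod_right' (f := fun p : ℝ × Spacetime =>
            ((alignedSecond θ).indicator 1 (p.1, p.2.snd) * G p.2) ^ 2)
              (by fun_prop)).aemeasurable)
      -- One power of `θ` comes from `K` and one from each frame average; `884736 = 192 * 4 * 24 *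
      -- 48`.
      _ ≤ (K * (ENNReal.ofReal (24 * θ) * ∫⁻ ζ, F ζ ^ 2)) *
          (ENNReal.ofReal (24 * (2 * θ)) * ∫⁻ ζ, G ζ ^ 2) := by
          rw [lintegral_const_mul _ (Measurable.lintegral_prod_right'
            (f := fun p : ℝ × Spacetime =>
              ((alignedFirst θ).indicator 1 (p.1, p.2.snd) * F p.2) ^ 2) (by fun_prop))]
          gcongr
          · exact lintegral_lintegral_aligned_le (measurableSet_alignedFirst θ)
              (fun ξ hξ => volume_abs_across_le hξ θ) hF
          · exact lintegral_lintegral_aligned_le (measurableSet_alignedSecond θ)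
              (fun ξ hξ => volume_abs_along_le hξ (2 * θ)) hG
      _ = _ := by
          rw [hK, ENNReal.ofReal_mul (by norm_num), ENNReal.ofReal_mul (by norm_num),
            ENNReal.ofReal_mul (by norm_num), ENNReal.ofReal_mul (by norm_num), ← ht]
          simp only [ENNReal.ofReal_ofNat]
          ring
  exact (ENNReal.mul_le_mul_iff_right (pow_ne_zero 2 ht0) (ENNReal.pow_ne_top htop)).mp main

/-! ### Weighted transforms and absolute convergence. -/

theorem eLpNorm_two_sq {α E : Type*} [MeasurableSpace α] [NormedAddCommGroup E] {μ : Measure α}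
    (f : α → E) : eLpNorm f 2 μ ^ 2 = ∫⁻ x, ‖f x‖ₑ ^ 2 ∂μ := by
  have := eLpNorm_nnreal_pow_eq_lintegral (f := f) (μ := μ) (p := 2) two_ne_zero
  simp only [NNReal.coe_ofNat, ENNReal.coe_ofNat, ENNReal.rpow_two] at this
  exact this

theorem measurable_stFourier (v : Lp ℂ 2 (volume : Measure Spacetime)) :
    Measurable (stFourier v) :=
  (Lp.stronglyMeasurable _).measurable.comp (measurable_const_smul _)

/-- The modulus of `⟨τ + |ξ|²⟩^b ṽ(τ, ξ)`. -/
def weightedFourier (b : ℝ) (v : Lp ℂ 2 (volume : Measure Spacetime)) (ζ : Spacetime) : ENNReal :=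
  ENNReal.ofReal (bracket (ζ.fst + ‖ζ.snd‖ ^ 2) ^ b) * ‖stFourier v ζ‖ₑ

theorem measurable_weightedFourier (b : ℝ) (v : Lp ℂ 2 (volume : Measure Spacetime)) :
    Measurable (weightedFourier b v) := by
  have := measurable_stFourier v
  unfold weightedFourier bracket
  fun_prop

theorem dispersiveWeight_mul_weightedFourier (b : ℝ) (v : Lp ℂ 2 (volume : Measure Spacetime))
    (ζ : Spacetime) : dispersiveWeight b ζ * weightedFourier b v ζ = ‖stFourier v ζ‖ₑ := by
  have hp : 0 < bracket (ζ.fst + ‖ζ.snd‖ ^ 2) := zero_lt_one.trans_le (one_le_bracket _)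
  rw [dispersiveWeight, weight, weightedFourier, ← mul_assoc,
    ← ENNReal.ofReal_mul (Real.rpow_nonneg hp.le _), ← Real.rpow_add hp, neg_add_cancel,
    Real.rpow_zero, ENNReal.ofReal_one, one_mul]

theorem lintegral_weightedFourier_sq (b : ℝ) (v : Lp ℂ 2 (volume : Measure Spacetime)) :
    ∫⁻ ζ, weightedFourier b v ζ ^ 2 = XNorm 0 b v ^ 2 := by
  rw [XNorm, eLpNorm_two_sq]
  refine lintegral_congr fun ζ => ?_
  have hp : 0 < bracket (ζ.fst + ‖ζ.snd‖ ^ 2) := zero_lt_one.trans_le (one_le_bracket _)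
  rw [weightedFourier, enorm_mul, Real.rpow_zero, one_mul, ← ofReal_norm (Complex.ofReal _),
    Complex.norm_real,
    Real.norm_of_nonneg (Real.rpow_nonneg hp.le _)]

/-- For each `ξ`, translating in `τ` gives the same finite integral since `b > 1/2`; only the area
of the disc remains. -/
theorem lintegral_indicator_ball_dispersiveWeight_lt_top {b : ℝ} (hb : 1 / 2 < b) (R : ℝ) :
    ∫⁻ ζ : Spacetime, ((Metric.closedBall (0 : Plane) R).indicator 1 ζ.snd *
      dispersiveWeight b ζ) ^ 2 < ⊤ := by
  have hw := measurable_dispersiveWeight b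
  have hw' := measurable_weight b
  have hB : MeasurableSet (Metric.closedBall (0 : Plane) R) :=
    Metric.isClosed_closedBall.measurableSet
  have hi : Measurable ((Metric.closedBall (0 : Plane) R).indicator (1 : Plane → ENNReal)) :=
    measurable_one.indicator hB
  rw [lintegral_spacetime (by fun_prop)]
  have : ∀ ξ : Plane, ∫⁻ τ : ℝ, ((Metric.closedBall (0 : Plane) R).indicator 1
      (WithLp.toLp 2 (τ, ξ) : Spacetime).snd * dispersiveWeight b (WithLp.toLp 2 (τ, ξ))) ^ 2 =
      (Metric.closedBall (0 : Plane) R).indicator 1 ξ * ∫⁻ s, weight b s ^ 2 := fun ξ => by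
    rw [← lintegral_add_right_eq_self (fun s => weight b s ^ 2) (‖ξ‖ ^ 2),
      ← lintegral_const_mul _ (by fun_prop)]
    refine lintegral_congr fun τ => ?_
    simp only [dispersiveWeight, WithLp.toLp_fst, WithLp.toLp_snd, mul_pow]
    congr 1
    by_cases h : ξ ∈ Metric.closedBall (0 : Plane) R
    · simp only [Set.indicator_of_mem h, Pi.one_apply, one_pow]
    · simp only [Set.indicator_of_notMem h, ne_eq, OfNat.ofNat_ne_zero, not_false_eq_true, zero_pow]
  simp_rw [this]
  rw [lintegral_mul_const _ hi, lintegral_indicator_one hB]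
  exact ENNReal.mul_lt_top measure_closedBall_lt_top (lintegral_weight_sq_lt_top hb)

/-- Functions in `X^{0,b}`, `b > 1/2`, with bounded spatial frequency have an integrable spacetime
Fourier transform. -/
theorem integrable_stFourier {b : ℝ} (hb : 1 / 2 < b) {A N : ℝ}
    {v : Lp ℂ 2 (volume : Measure Spacetime)} (hv : MemX 0 b v)
    (hN : HasSpatialFrequency A N v) : Integrable (stFourier v) := by
  refine ⟨(measurable_stFourier v).aestronglyMeasurable, ?_⟩
  have hw := measurable_dispersiveWeight b
  have hi : Measurable ((Metric.closedBall (0 : Plane) (A * N)).indicator (1 : Plane → ENNReal)) :=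
    measurable_one.indicator Metric.isClosed_closedBall.measurableSet
  -- Since `‖ξ‖ ≤ ⟨ξ⟩ ≤ A * N` on the support, the disc cut-off may be inserted; Cauchy–Schwarz then
  -- separates it and the weight from the `X^{0,b}` density.
  have e : ∫⁻ ζ, ‖stFourier v ζ‖ₑ = ∫⁻ ζ : Spacetime,
      ((Metric.closedBall (0 : Plane) (A * N)).indicator 1 ζ.snd * dispersiveWeight b ζ) *
        weightedFourier b v ζ := by
    refine lintegral_congr_ae ?_
    filter_upwards [hN] with ζ hζ
    rw [mul_assoc, dispersiveWeight_mul_weightedFourier]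
    by_cases h : ζ.snd ∈ Metric.closedBall (0 : Plane) (A * N)
    · rw [Set.indicator_of_mem h, Pi.one_apply, one_mul]
    · rw [Set.indicator_of_notMem h, zero_mul, hζ, enorm_zero]
      rintro ⟨-, h2⟩
      refine h (mem_closedBall_zero_iff.mpr (le_trans ?_ h2))
      exact Real.le_sqrt_of_sq_le (by linarith)
  have h := lintegral_mul_sq_le (μ := volume)
    (f := fun ζ : Spacetime =>
      (Metric.closedBall (0 : Plane) (A * N)).indicator 1 ζ.snd * dispersiveWeight b ζ)
    (g := weightedFourier b v) (by fun_prop) (measurable_weightedFourier b v).aemeasurable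
  rw [lintegral_weightedFourier_sq] at h
  rw [HasFiniteIntegral, e]
  have := h.trans_lt (ENNReal.mul_lt_top (lintegral_indicator_ball_dispersiveWeight_lt_top hb _)
    (ENNReal.pow_lt_top hv))
  exact (ENNReal.pow_lt_top_iff.mp this).resolve_right two_ne_zero

/-! ### The bilinear product as a Fourier transform. -/

/-- The integrand of `angularProduct` without its oscillating factor. -/
def angularSymbol (θ : ℝ) (v₁ v₂ : Lp ℂ 2 (volume : Measure Spacetime))
    (p : Spacetime × Spacetime) : ℂ :=
  (nearlyOrthogonal θ).indicator 1 (p.1.snd, p.2.snd) * (stFourier v₁ p.1 * stFourier v₂ p.2)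

theorem spacetime_inner (z ζ : Spacetime) :
    inner ℝ z ζ = z.fst * ζ.fst + inner ℝ z.snd ζ.snd := by
  rw [WithLp.prod_inner_apply]
  simp [mul_comm]

theorem angularIntegrand_eq (θ : ℝ) (v₁ v₂ : Lp ℂ 2 (volume : Measure Spacetime)) (z : Spacetime)
    (p : Spacetime × Spacetime) : angularIntegrand θ v₁ v₂ z p =
      Complex.exp (Complex.I * (inner ℝ z (p.1 + p.2) : ℝ)) * angularSymbol θ v₁ v₂ p := by
  rw [angularIntegrand, angularSymbol, spacetime_inner, WithLp.add_fst, WithLp.add_snd, mul_assoc,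
    mul_assoc]
  congr 2

theorem integrable_angularSymbol (θ : ℝ) {v₁ v₂ : Lp ℂ 2 (volume : Measure Spacetime)}
    (h₁ : Integrable (stFourier v₁)) (h₂ : Integrable (stFourier v₂)) :
    Integrable (angularSymbol θ v₁ v₂) := by
  have h := h₁.mul_prod h₂
  refine h.mono ?_ (Filter.Eventually.of_forall fun p => ?_)
  · have m1 := measurable_stFourier v₁
    have m2 := measurable_stFourier v₂
    have m3 : Measurable ((nearlyOrthogonal θ).indicator (1 : Plane × Plane → ℂ)) :=
      measurable_one.indicator (measurableSet_nearlyOrthogonal θ)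
    refine Measurable.aestronglyMeasurable ?_
    unfold angularSymbol
    fun_prop
  · rw [angularSymbol, norm_mul]
    refine mul_le_of_le_one_left (norm_nonneg _) ?_
    by_cases hp : (p.1.snd, p.2.snd) ∈ nearlyOrthogonal θ <;> simp [Set.indicator, hp]

theorem integrable_angularIntegrand (θ : ℝ) {v₁ v₂ : Lp ℂ 2 (volume : Measure Spacetime)}
    (h₁ : Integrable (stFourier v₁)) (h₂ : Integrable (stFourier v₂)) (z : Spacetime) :
    Integrable (angularIntegrand θ v₁ v₂ z) := by
  have h := integrable_angularSymbol θ h₁ h₂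
  simp_rw [funext (angularIntegrand_eq θ v₁ v₂ z)]
  refine h.bdd_mul (c := 1) ?_ (Filter.Eventually.of_forall fun p => ?_)
  · exact Continuous.aestronglyMeasurable (by fun_prop)
  · rw [mul_comm, Complex.norm_exp_ofReal_mul_I]

/-- The density of the bilinear interaction on the Fourier side. -/
def angularDensity (θ : ℝ) (v₁ v₂ : Lp ℂ 2 (volume : Measure Spacetime)) (ζ : Spacetime) : ℂ :=
  ∫ x : Spacetime, angularSymbol θ v₁ v₂ (x, ζ - x)

theorem measurePreserving_sub_shear :
    MeasurePreserving (fun p : Spacetime × Spacetime => (p.1, p.2 - p.1)) :=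
  measurePreserving_prod_sub volume volume

theorem measurableEmbedding_sub_shear :
    MeasurableEmbedding (fun p : Spacetime × Spacetime => (p.1, p.2 - p.1)) :=
  (MeasurableEquiv.shearSubRight Spacetime).measurableEmbedding

theorem integrable_angularDensity (θ : ℝ) {v₁ v₂ : Lp ℂ 2 (volume : Measure Spacetime)}
    (h₁ : Integrable (stFourier v₁)) (h₂ : Integrable (stFourier v₂)) :
    Integrable (angularDensity θ v₁ v₂) :=
  Integrable.integral_prod_right (μ := volume) (ν := volume)
    (f := fun p : Spacetime × Spacetime => angularSymbol θ v₁ v₂ (p.1, p.2 - p.1))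
    (measurePreserving_sub_shear.integrable_comp_of_integrable (integrable_angularSymbol θ h₁ h₂))

theorem enorm_angularDensity_le (b θ : ℝ) (v₁ v₂ : Lp ℂ 2 (volume : Measure Spacetime))
    (ζ : Spacetime) : ‖angularDensity θ v₁ v₂ ζ‖ₑ ≤
      angularConvolution b θ (weightedFourier b v₁) (weightedFourier b v₂) ζ := by
  refine (enorm_integral_le_lintegral_enorm _).trans (le_of_eq (lintegral_congr fun x => ?_))
  rw [dispersiveWeight_mul_weightedFourier, dispersiveWeight_mul_weightedFourier, angularSymbol,
    enorm_mul, enorm_mul]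
  congr 1
  by_cases hp : (x.snd, (ζ - x).snd) ∈ nearlyOrthogonal θ <;> 
    simp only [Set.indicator_of_mem, Set.indicator_of_notMem, hp, not_false_eq_true, Pi.one_apply,
      enorm_one, enorm_zero]

open FourierTransform in
-- The shear `(x, ζ) ↦ (x, ζ - x)` preserves measure and makes the phase depend on the total
-- frequency `ζ` only. Evaluation at `-(2π)⁻¹ z` converts the kernel `e^{-2πi⟨·,·⟩}` into
-- `e^{i⟨z,ζ⟩}`.
theorem angularProduct_eq (θ : ℝ) {v₁ v₂ : Lp ℂ 2 (volume : Measure Spacetime)}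
    (h₁ : Integrable (stFourier v₁)) (h₂ : Integrable (stFourier v₂)) (z : Spacetime) :
    angularProduct θ v₁ v₂ z = 𝓕 (angularDensity θ v₁ v₂) ((-(2 * Real.pi)⁻¹) • z) := by
  have hi : Integrable (fun p : Spacetime × Spacetime =>
      angularIntegrand θ v₁ v₂ z (p.1, p.2 - p.1)) :=
    measurePreserving_sub_shear.integrable_comp_of_integrable
      (integrable_angularIntegrand θ h₁ h₂ z)
  rw [angularProduct, ← measurePreserving_sub_shear.integral_comp measurableEmbedding_sub_shear,
    Measure.volume_eq_prod, integral_prod_symm _ hi, Real.fourier_eq']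
  refine integral_congr_ae (Filter.Eventually.of_forall fun ζ => ?_)
  simp only [angularIntegrand_eq, add_sub_cancel]
  rw [integral_const_mul, smul_eq_mul, angularDensity]
  congr 2
  rw [mul_comm, inner_smul_right, real_inner_comm]
  congr 2
  field_simp

theorem eLpNorm_angularDensity_sq_le {b : ℝ} (hb : 0 ≤ b) {θ : ℝ} (hθ : 0 < θ)
    (hθ' : θ < 1 / 50) (v₁ v₂ : Lp ℂ 2 (volume : Measure Spacetime)) :
    eLpNorm (angularDensity θ v₁ v₂) 2 volume ^ 2 ≤
      ENNReal.ofReal θ * (884736 * (∫⁻ s, weight b s ^ 2) ^ 2) *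
        (XNorm 0 b v₁ ^ 2 * XNorm 0 b v₂ ^ 2) := by
  rw [eLpNorm_two_sq, ← lintegral_weightedFourier_sq, ← lintegral_weightedFourier_sq]
  refine le_trans (lintegral_mono fun ζ => ?_) (lintegral_angularConvolution_sq_le hb hθ hθ'
    (measurable_weightedFourier b v₁) (measurable_weightedFourier b v₂))
  gcongr
  exact enorm_angularDensity_le b θ v₁ v₂ ζ

theorem eLpNorm_comp_smul_sq {E F : Type*} [NormedAddCommGroup E] [NormedSpace ℝ E]
    [FiniteDimensional ℝ E] [MeasurableSpace E] [BorelSpace E] [NormedAddCommGroup F]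
    (μ : Measure E) [μ.IsAddHaarMeasure] {r : ℝ} (hr : r ≠ 0) (f : E → F) :
    eLpNorm (fun x => f (r • x)) 2 μ ^ 2 =
      ENNReal.ofReal |(r ^ Module.finrank ℝ E)⁻¹| * eLpNorm f 2 μ ^ 2 := by
  rw [eLpNorm_two_sq, eLpNorm_two_sq, lintegral_comp_smul μ hr (fun x => ‖f x‖ₑ ^ 2)]

end AngularStrichartz

end

/-! ### Assembly of the estimate. -/

theorem mainTheorem6 (ε : ℝ) (hε : 0 < ε) (A : ℝ) (hA : 1 ≤ A) :
    ∃ C : ℝ, 0 < C ∧ ∀ N₁ N₂ θ : ℝ, 0 < N₁ → N₁ ≤ N₂ → 0 < θ → θ < 1 / 50 →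
      ∀ v₁ v₂ : MeasureTheory.Lp ℂ 2
          (MeasureTheory.volume : MeasureTheory.Measure AngularStrichartz.Spacetime),
        AngularStrichartz.MemX 0 (1 / 2 + ε) v₁ → AngularStrichartz.MemX 0 (1 / 2 + ε) v₂ →
        AngularStrichartz.HasSpatialFrequency A N₁ v₁ →
        AngularStrichartz.HasSpatialFrequency A N₂ v₂ →
        (∀ z : AngularStrichartz.Spacetime, MeasureTheory.Integrable
          (AngularStrichartz.angularIntegrand θ v₁ v₂ z) MeasureTheory.volume) ∧
        MeasureTheory.MemLp (AngularStrichartz.angularProduct θ v₁ v₂) 2 MeasureTheory.volume ∧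
        MeasureTheory.eLpNorm (AngularStrichartz.angularProduct θ v₁ v₂) 2 MeasureTheory.volume ≤
          ENNReal.ofReal (C * θ ^ (1 / 2 : ℝ)) *
            AngularStrichartz.XNorm 0 (1 / 2 + ε) v₁ * AngularStrichartz.XNorm 0 (1 / 2 + ε) v₂ := by
  have hb : 1 / 2 < 1 / 2 + ε := by linarith
  have hb0 : 0 ≤ 1 / 2 + ε := by linarith
  set b := 1 / 2 + ε
  have hc : -(2 * Real.pi)⁻¹ ≠ 0 := neg_ne_zero.mpr (by positivity)
  -- `D` is the Jacobian of the rescaling by `-(2π)⁻¹` in `angularProduct_eq`.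
  set D : ℝ := |((-(2 * Real.pi)⁻¹) ^ Module.finrank ℝ AngularStrichartz.Spacetime)⁻¹|
  set Ω : ENNReal := ∫⁻ s, AngularStrichartz.weight b s ^ 2
  have hΩ : Ω ≠ ⊤ := (AngularStrichartz.lintegral_weight_sq_lt_top hb).ne
  have hM : 0 ≤ D * (884736 * Ω.toReal ^ 2) := by positivity
  -- The summand `1` makes positivity of the constant immediate.
  refine ⟨Real.sqrt (D * (884736 * Ω.toReal ^ 2)) + 1, by positivity, ?_⟩
  intro N₁ N₂ θ _ _ hθ hθ' v₁ v₂ hv₁ hv₂ hN₁ hN₂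
  have i₁ := AngularStrichartz.integrable_stFourier hb hv₁ hN₁
  have i₂ := AngularStrichartz.integrable_stFourier hb hv₂ hN₂
  have hd := AngularStrichartz.integrable_angularDensity θ i₁ i₂
  have hle := AngularStrichartz.eLpNorm_angularDensity_sq_le hb0 hθ hθ' v₁ v₂
  have hd2 : MemLp (AngularStrichartz.angularDensity θ v₁ v₂) 2 := by
    refine ⟨hd.aestronglyMeasurable, ?_⟩
    refine (ENNReal.pow_lt_top_iff.mp (hle.trans_lt ?_)).resolve_right two_ne_zero
    exact ENNReal.mul_lt_top (ENNReal.mul_lt_top ENNReal.ofReal_lt_top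
        (ENNReal.mul_lt_top (by norm_num) (ENNReal.pow_lt_top hΩ.lt_top)))
      (ENNReal.mul_lt_top (ENNReal.pow_lt_top hv₁) (ENNReal.pow_lt_top hv₂))
  have hbound : eLpNorm (AngularStrichartz.angularProduct θ v₁ v₂) 2 volume ≤
      ENNReal.ofReal ((Real.sqrt (D * (884736 * Ω.toReal ^ 2)) + 1) * θ ^ (1 / 2 : ℝ)) *
        AngularStrichartz.XNorm 0 b v₁ * AngularStrichartz.XNorm 0 b v₂ := by
    rw [← ENNReal.pow_le_pow_left_iff two_ne_zero,
      funext (AngularStrichartz.angularProduct_eq θ i₁ i₂),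
      AngularStrichartz.eLpNorm_comp_smul_sq volume hc, eLpNorm_fourier_eq hd hd2]
    have hconst : ENNReal.ofReal D * (ENNReal.ofReal θ * (884736 * Ω ^ 2)) ≤
        ENNReal.ofReal ((Real.sqrt (D * (884736 * Ω.toReal ^ 2)) + 1) * θ ^ (1 / 2 : ℝ)) ^ 2 := by
      have e : ENNReal.ofReal D * (ENNReal.ofReal θ * (884736 * Ω ^ 2)) =
          ENNReal.ofReal (D * (θ * (884736 * Ω.toReal ^ 2))) := by
        rw [ENNReal.ofReal_mul (abs_nonneg _), ENNReal.ofReal_mul hθ.le,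
          ENNReal.ofReal_mul (by norm_num), ENNReal.ofReal_pow ENNReal.toReal_nonneg,
          ENNReal.ofReal_toReal hΩ, ENNReal.ofReal_ofNat]
      rw [e, ← ENNReal.ofReal_pow (by positivity)]
      refine ENNReal.ofReal_le_ofReal ?_
      rw [mul_pow, ← Real.sqrt_eq_rpow, Real.sq_sqrt hθ.le]
      have hs := Real.sq_sqrt hM
      have hs' := Real.sqrt_nonneg (D * (884736 * Ω.toReal ^ 2))
      calc D * (θ * (884736 * Ω.toReal ^ 2)) = D * (884736 * Ω.toReal ^ 2) * θ := by ring
        _ ≤ _ := by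
          gcongr
          linarith
    calc _ ≤ ENNReal.ofReal D * (ENNReal.ofReal θ * (884736 * Ω ^ 2) *
          (AngularStrichartz.XNorm 0 b v₁ ^ 2 * AngularStrichartz.XNorm 0 b v₂ ^ 2)) := by
          gcongr
      _ = ENNReal.ofReal D * (ENNReal.ofReal θ * (884736 * Ω ^ 2)) *
          (AngularStrichartz.XNorm 0 b v₁ ^ 2 * AngularStrichartz.XNorm 0 b v₂ ^ 2) := by ring
      _ ≤ _ := mul_le_mul_left hconst _
      _ = _ := by ring
  refine ⟨AngularStrichartz.integrable_angularIntegrand θ i₁ i₂, ⟨?_, ?_⟩, hbound⟩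
  · rw [funext (AngularStrichartz.angularProduct_eq θ i₁ i₂)]
    exact ((VectorFourier.fourierIntegral_continuous Real.continuous_fourierChar continuous_inner
      hd).comp (continuous_const_smul _)).aestronglyMeasurable
  · exact hbound.trans_lt (ENNReal.mul_lt_top (ENNReal.mul_lt_top ENNReal.ofReal_lt_top hv₁) hv₂)
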